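/- Let $d\ge 1$, $\mathbb T^d=(\mathbb R/\mathbb Z)^d$, $H^0=L^2(\mathbb T^d;\mathbb C)$ and $H^2=H^2(\mathbb T^d)$ (the usual Sobolev space). For $\lambda\in[0,1)$ let $K_1^\lambda,K_2^\lambda,K^\lambda$ be bounded linear operators on $H^0$ with $K_1^\lambda,K_2^\lambda$ selfadjoint, such that each of the three families is bounded in operator norm uniformly in $\lambda\in[0,1)$ and is strongly continuous: $K_i^\lambda u\to K_i^{s}u$ and $K^\lambda u\to K^{s}u$ in $H^0$ as $\lambda\to s$, for all $u\in H^0$ and $s\in[0,1)$. Let $A_i^\lambda=-\Delta+K_i^\lambda$ ($i=1,2$), with domain $H^2$, and let $$M^\lambda=\begin{pmatrix}A_1^\lambda & K^\lambda\\ (K^\lambda)^* & -A_2^\lambda\end{pmatrix}$$ be the operator in $H^0\times H^0$ with domain $H^2\times H^2$. List the eigenvalues of $A_1^0$ in ascending order, counted with multiplicity, with corresponding orthonormal eigenvectors $v_0,v_1,\dots$, and let $P_n$ be the orthogonal projection of $H^0$ onto the span of $v_0,\dots,v_{n-1}$; let $Q_n$ be defined in the same way from $A_2^0$. Let $$M_n^\lambda=\begin{pmatrix}P_nA_1^\lambda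 P_n & P_nK^\lambda Q_n\\ Q_n(K^\lambda)^*P_n & -Q_nA_2^\lambda Q_n\end{pmatrix},$$ regarded as a linear operator on the finite-dimensional space $R(P_n)\times R(Q_n)$, where $R(\cdot)$ denotes the range. Let $\sigma\in\mathbb C$ be in the resolvent set $\rho(M^0)$. Then there exist an integer $N=N(\sigma)>0$ and a number $\lambda^*=\lambda^*(\sigma)\in(0,1]$ such that $\sigma\in\rho(M_n^\lambda)$ for all $n>N$ and all $0<\lambda<\lambda^*$. -/

import Mathlib

open MeasureTheory Filter Topology
open scoped InnerProductSpace

noncomputable section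

namespace BlockSchrodinger

/-- `H⁰ = L²(𝕋ᵈ; ℂ)`, where `𝕋ᵈ = (ℝ/ℤ)ᵈ` carries its Haar probability measure. -/
abbrev H0 (d : ℕ) : Type :=
  Lp ℂ 2 (Measure.pi fun _ : Fin d => (AddCircle.haarAddCircle : Measure UnitAddCircle))

/-- The orthonormal basis `e^{2πi k·x}`, `k ∈ ℤᵈ`, of `H⁰`. -/
def fourierBasis (d : ℕ) : HilbertBasis (Fin d → ℤ) ℂ (H0 d) :=
  UnitAddTorus.mFourierBasis

/-- The Fourier coefficient `û(k) = ∫ u(x) e^{-2πi k·x} dx`, `k ∈ ℤᵈ`. -/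
def fourierCoef {d : ℕ} (u : H0 d) (k : Fin d → ℤ) : ℂ :=
  UnitAddTorus.mFourierCoeff u k

/-- `|k|²` for `k ∈ ℤᵈ`. -/
def freqSq {d : ℕ} (k : Fin d → ℤ) : ℝ := ∑ i, (k i : ℝ) ^ 2

theorem fourierCoef_eq_repr {d : ℕ} (u : H0 d) (k : Fin d → ℤ) :
    fourierCoef u k = (fourierBasis d).repr u k :=
  (UnitAddTorus.mFourierBasis_repr u k).symm

theorem fourierCoef_add {d : ℕ} (u v : H0 d) (k : Fin d → ℤ) :
    fourierCoef (u + v) k = fourierCoef u k + fourierCoef v k := by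
  simp only [fourierCoef_eq_repr, map_add, lp.coeFn_add, Pi.add_apply]

theorem fourierCoef_smul {d : ℕ} (c : ℂ) (u : H0 d) (k : Fin d → ℤ) :
    fourierCoef (c • u) k = c * fourierCoef u k := by
  simp only [fourierCoef_eq_repr, map_smul, lp.coeFn_smul, Pi.smul_apply, smul_eq_mul]

/-- The Sobolev space `H² = H²(𝕋ᵈ)`: all `u ∈ H⁰` with `∑ₖ (1 + |k|²)² |û(k)|² < ∞`. -/
def H2 (d : ℕ) : Submodule ℂ (H0 d) where
  carrier := {u | Memℓp (fun k : Fin d → ℤ => ((1 + freqSq k : ℝ) : ℂ) * fourierCoef u k) 2}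
  zero_mem' := by
    have h : (fun k : Fin d → ℤ => ((1 + freqSq k : ℝ) : ℂ) * fourierCoef (0 : H0 d) k) = 0 := by
      funext k
      simp [fourierCoef_eq_repr]
    change Memℓp _ 2
    rw [h]
    exact zero_memℓp
  add_mem' := by
    intro u v hu hv
    have h := Memℓp.add hu hv
    refine (congrArg (fun f => Memℓp f 2) ?_).mp h
    funext k
    simp only [Pi.add_apply, fourierCoef_add, mul_add]
  smul_mem' := by
    intro c u hu
    have h := Memℓp.const_smul hu c
    refine (congrArg (fun f => Memℓp f 2) ?_).mp h
    funext k
    simp only [Pi.smul_apply, fourierCoef_smul, smul_eq_mul]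
    ring

theorem memℓp_negLaplacian {d : ℕ} (u : H2 d) :
    Memℓp (fun k : Fin d → ℤ =>
      ((4 * Real.pi ^ 2 * freqSq k : ℝ) : ℂ) * fourierCoef (u : H0 d) k) 2 := by
  have h1 : Memℓp (fun k : Fin d → ℤ =>
      ((1 + freqSq k : ℝ) : ℂ) * fourierCoef (u : H0 d) k) 2 := u.2
  have h2 : Memℓp (fun k : Fin d → ℤ => fourierCoef (u : H0 d) k) 2 := by
    simpa only [fourierCoef_eq_repr] using
      lp.memℓp ((fourierBasis d).repr (u : H0 d))
  refine (congrArg (fun f => Memℓp f 2) ?_).mp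
    ((h1.sub h2).const_smul ((4 * Real.pi ^ 2 : ℝ) : ℂ))
  funext k
  simp only [Pi.smul_apply, Pi.sub_apply, smul_eq_mul]
  push_cast
  ring

/-- `-Δ` as an unbounded operator in `H⁰` with domain `H²`: the function `-Δ u` has the Fourier
coefficients `4π²|k|² û(k)`. -/
def negLaplacian (d : ℕ) : H0 d →ₗ.[ℂ] H0 d where
  domain := H2 d
  toFun :=
    { toFun := fun u => (fourierBasis d).repr.symm
        ⟨fun k => ((4 * Real.pi ^ 2 * freqSq k : ℝ) : ℂ) * fourierCoef (u : H0 d) k,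
          memℓp_negLaplacian u⟩
      map_add' := by
        intro u v
        rw [← map_add]
        congr 1
        ext k
        simp only [Submodule.coe_add, fourierCoef_add, lp.coeFn_add, Pi.add_apply, mul_add]
      map_smul' := by
        intro c u
        rw [RingHom.id_apply, ← map_smul]
        congr 1
        ext k
        simp only [Submodule.coe_smul, fourierCoef_smul, lp.coeFn_smul, Pi.smul_apply,
          smul_eq_mul]
        ring }

/-- The Schrödinger operator `-Δ + K` in `H⁰` with domain `H²`. -/
def schrodinger {d : ℕ} (K : H0 d →L[ℂ] H0 d) : H0 d →ₗ.[ℂ] H0 d where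
  domain := H2 d
  toFun := (show H2 d →ₗ[ℂ] H0 d from (negLaplacian d).toFun) + (K : H0 d →ₗ[ℂ] H0 d) ∘ₗ (H2 d).subtype

/-- The block operator `M = [[-Δ + K₁, K], [K*, -(-Δ + K₂)]]` in `H⁰ × H⁰` with domain
`H² × H²`. -/
def blockOp {d : ℕ} (K₁ K₂ K : H0 d →L[ℂ] H0 d) : (H0 d × H0 d) →ₗ.[ℂ] (H0 d × H0 d) where
  domain := (H2 d).prod (H2 d)
  toFun :=
    { toFun := fun u =>
        (schrodinger K₁ ⟨u.1.1, u.2.1⟩ + K u.1.2,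
          ContinuousLinearMap.adjoint K u.1.1 - schrodinger K₂ ⟨u.1.2, u.2.2⟩)
      map_add' := by
        intro u v
        have h1 := (schrodinger K₁).map_add ⟨u.1.1, u.2.1⟩ ⟨v.1.1, v.2.1⟩
        have h2 := (schrodinger K₂).map_add ⟨u.1.2, u.2.2⟩ ⟨v.1.2, v.2.2⟩
        ext1
        · simp only [Submodule.coe_add, Prod.fst_add, Prod.snd_add, map_add]
          refine (congrArg (· + (K u.1.2 + K v.1.2)) h1).trans ?_
          abel
        · simp only [Submodule.coe_add, Prod.fst_add, Prod.snd_add, map_add]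
          refine (congrArg (ContinuousLinearMap.adjoint K u.1.1 +
            ContinuousLinearMap.adjoint K v.1.1 - ·) h2).trans ?_
          abel
      map_smul' := by
        intro c u
        have h1 := (schrodinger K₁).map_smul c ⟨u.1.1, u.2.1⟩
        have h2 := (schrodinger K₂).map_smul c ⟨u.1.2, u.2.2⟩
        ext1
        · simp only [Submodule.coe_smul, Prod.smul_fst, Prod.smul_snd, map_smul,
            RingHom.id_apply, smul_add]
          exact congrArg (· + c • K u.1.2) h1
        · simp only [Submodule.coe_smul, Prod.smul_fst, Prod.smul_snd, map_smul,
            RingHom.id_apply, smul_sub]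
          exact congrArg (c • ContinuousLinearMap.adjoint K u.1.1 - ·) h2 }

/-- The resolvent set `ρ(T)` of an unbounded operator `T`: all `σ` for which `T - σ`, from the
domain of `T` to the whole space, is a bijection with bounded inverse `R`. -/
def unboundedResolventSet {E : Type*} [NormedAddCommGroup E] [NormedSpace ℂ E]
    (T : E →ₗ.[ℂ] E) : Set ℂ :=
  {σ | ∃ R : E →L[ℂ] E,
    (∀ y : E, ∃ h : R y ∈ T.domain, T ⟨R y, h⟩ - σ • R y = y) ∧
    ∀ x : T.domain, R (T x - σ • (x : E)) = x}

/-- `(α₀, v₀), (α₁, v₁), …` is an enumeration of the eigenvalues of `T`, in ascending order and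
counted with multiplicity, together with corresponding orthonormal eigenvectors. -/
structure IsEigenEnumeration {d : ℕ} (T : H0 d →ₗ.[ℂ] H0 d) (α : ℕ → ℝ) (v : ℕ → T.domain) :
    Prop where
  monotone : Monotone α
  orthonormal : Orthonormal ℂ (fun i => (v i : H0 d))
  apply_eq : ∀ i, T (v i) = (α i : ℂ) • (v i : H0 d)
  /-- Every eigenvalue occurs as often as its multiplicity says: the `vᵢ` with `αᵢ = μ` span the
  whole eigenspace of `μ`. -/
  exhaustive : ∀ (μ : ℝ) (u : T.domain), T u = (μ : ℂ) • (u : H0 d) →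
    (u : H0 d) ∈ Submodule.span ℂ ((fun i => (v i : H0 d)) '' {i | α i = μ})

/-- The span of the first `n` vectors `v₀, …, vₙ₋₁`. -/
def firstSpan {d : ℕ} (v : ℕ → H2 d) (n : ℕ) : Submodule ℂ (H0 d) :=
  Submodule.span ℂ (Set.range fun i : Fin n => (v i : H0 d))

instance firstSpan_finiteDimensional {d : ℕ} (v : ℕ → H2 d) (n : ℕ) :
    FiniteDimensional ℂ (firstSpan v n) :=
  FiniteDimensional.span_of_finite ℂ (Set.finite_range _)

theorem firstSpan_le {d : ℕ} (v : ℕ → H2 d) (n : ℕ) : firstSpan v n ≤ H2 d := by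
  refine Submodule.span_le.mpr ?_
  rintro _ ⟨i, rfl⟩
  exact (v i).2

/-- The orthogonal projection `Pₙ` of `H⁰` onto the span of `v₀, …, vₙ₋₁`, as a map onto its
range. -/
def proj {d : ℕ} (v : ℕ → H2 d) (n : ℕ) : H0 d →ₗ[ℂ] firstSpan v n :=
  ((firstSpan v n).orthogonalProjectionOnto : H0 d →ₗ[ℂ] firstSpan v n)

/-- `Pₙ (-Δ + K) Pₙ` on the range of `Pₙ`. -/
def truncSchrodinger {d : ℕ} (K : H0 d →L[ℂ] H0 d) (v : ℕ → H2 d) (n : ℕ) :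
    firstSpan v n →ₗ[ℂ] firstSpan v n :=
  proj v n ∘ₗ (schrodinger K).toFun ∘ₗ Submodule.inclusion (firstSpan_le v n)

/-- `Pₙ B Qₙ` from the range of `Qₙ` to the range of `Pₙ`, where `Pₙ` and `Qₙ` are the projections
given by `v` and `w`. -/
def truncBounded {d : ℕ} (B : H0 d →L[ℂ] H0 d) (v w : ℕ → H2 d) (n : ℕ) :
    firstSpan w n →ₗ[ℂ] firstSpan v n :=
  proj v n ∘ₗ (B : H0 d →ₗ[ℂ] H0 d) ∘ₗ (firstSpan w n).subtype

/-- The truncated block operator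
`Mₙ = [[Pₙ(-Δ + K₁)Pₙ, Pₙ K Qₙ], [Qₙ K* Pₙ, -Qₙ(-Δ + K₂)Qₙ]]`,
a linear operator on the finite-dimensional space `R(Pₙ) × R(Qₙ)`. -/
def truncBlockOp {d : ℕ} (K₁ K₂ K : H0 d →L[ℂ] H0 d) (v w : ℕ → H2 d) (n : ℕ) :
    Module.End ℂ (firstSpan v n × firstSpan w n) :=
  LinearMap.prod
    (truncSchrodinger K₁ v n ∘ₗ LinearMap.fst ℂ _ _ + truncBounded K v w n ∘ₗ LinearMap.snd ℂ _ _)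
    (truncBounded (ContinuousLinearMap.adjoint K) w v n ∘ₗ LinearMap.fst ℂ _ _ -
      truncSchrodinger K₂ w n ∘ₗ LinearMap.snd ℂ _ _)

/-- The family `(K^lam)`, `0 ≤ lam < 1`, is bounded in operator norm and continuous in the strong
operator topology. -/
structure IsBoundedStronglyContinuous {d : ℕ} (K : ℝ → (H0 d →L[ℂ] H0 d)) : Prop where
  bounded : ∃ C : ℝ, ∀ lam ∈ Set.Ico (0 : ℝ) 1, ‖K lam‖ ≤ C
  strongly_continuous : ∀ s ∈ Set.Ico (0 : ℝ) 1, ∀ u : H0 d,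
    Tendsto (fun lam => K lam u) (𝓝[Set.Ico (0 : ℝ) 1] s) (𝓝 (K s u))

end BlockSchrodinger

end

open BlockSchrodinger

noncomputable section

namespace BlockSchrodinger

/-! Argue by contradiction. If no `N` and `lamStar` work, there are `n j → ∞`, `lam j → 0` and unit
eigenvectors `(p j, q j)` of the truncated operators with eigenvalue `σ`. Since `Pₙ` is built from
eigenvectors of `A₁⁰`, its range is invariant under `A₁⁰`; the first row reads `A₁⁰ p + Pₙ (K₁ -
K₁⁰) p + Pₙ K q = σ p`, and the second is similar. Applying `R₁ = (A₁⁰ + c₁)⁻¹` writes `p` as `R₁`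
of a bounded vector (`eq_of_truncBlockOp_apply`). As `R₁` and `R₂` are compact, a subsequence of `(p
j, q j)` converges in norm, so the limit `(x, y)` is nonzero. The equations pass to the limit
because `Pₙ` and `Qₙ` tend strongly to the identity, which is completeness of the eigenvectors
(`top_le_closure_iSup_firstSpan`). Strong continuity of `K` gives only weak convergence of the
adjoints; this suffices because `R₂` is symmetric (`exists_limit_solution`). Then `(x, y)` is an
eigenvector of `M⁰` at `σ`, against `σ ∈ ρ(M⁰)`. -/

/-! ### Diagonal operators on `ℓ²` and the resolvent of `-Δ`. -/

/-- The multiplication operator on `ℓ²(ι, ℂ)` by a bounded family `a`. -/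
def diagonalOp {ι : Type*} (a : ι → ℂ) {C : ℝ} (hC : 0 ≤ C) (ha : ∀ i, ‖a i‖ ≤ C) :
    lp (fun _ : ι => ℂ) 2 →L[ℂ] lp (fun _ : ι => ℂ) 2 :=
  lp.mapCLM 2 (fun i => a i • ContinuousLinearMap.id ℂ ℂ) hC (by
    intro i
    simpa [norm_smul] using ha i)

@[simp] theorem diagonalOp_apply {ι : Type*} (a : ι → ℂ) {C : ℝ} (hC : 0 ≤ C)
    (ha : ∀ i, ‖a i‖ ≤ C) (x : lp (fun _ : ι => ℂ) 2) (i : ι) :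
    diagonalOp a hC ha x i = a i * x i := by
  simp [diagonalOp]

theorem norm_diagonalOp_le {ι : Type*} (a : ι → ℂ) {C : ℝ} (hC : 0 ≤ C)
    (ha : ∀ i, ‖a i‖ ≤ C) : ‖diagonalOp a hC ha‖ ≤ C :=
  lp.norm_mapCLM_le 2 _ hC _

/-- The truncations to finite index sets have finite rank and converge in operator norm. -/
theorem isCompactOperator_diagonalOp {ι : Type*} (a : ι → ℂ) {C : ℝ} (hC : 0 ≤ C)
    (ha : ∀ i, ‖a i‖ ≤ C) (h0 : Tendsto a cofinite (𝓝 0)) :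
    IsCompactOperator (diagonalOp a hC ha) := by
  classical
  let F : Finset ι → lp (fun _ : ι => ℂ) 2 →L[ℂ] lp (fun _ : ι => ℂ) 2 := fun s =>
    ∑ i ∈ s, (a i • lp.singleContinuousLinearMap ℂ (fun _ : ι => ℂ) 2 i) ∘L
      lp.evalCLM ℂ (fun _ : ι => ℂ) 2 i
  have hFapply : ∀ s x i, F s x i = if i ∈ s then a i * x i else 0 := by
    intro s x i
    have e : F s x i = ∑ j ∈ s, (a j • lp.single 2 j (x j) : lp (fun _ : ι => ℂ) 2) i := by
      change lp.evalCLM ℂ (fun _ : ι => ℂ) 2 i (F s x) = _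
      simp only [F, sum_apply, map_sum]
      rfl
    rw [e]
    simp [Pi.single_apply, lp.coeFn_smul, lp.single_apply]
  have hFcompact : ∀ s, IsCompactOperator (F s) := by
    intro s
    have h1 : ∀ i, IsCompactOperator
        (a i • lp.singleContinuousLinearMap ℂ (fun _ : ι => ℂ) 2 i) := fun i =>
      isCompactOperator_of_locallyCompactSpace_rng _
    have h2 : F s ∈ compactOperator (RingHom.id ℂ) (lp (fun _ : ι => ℂ) 2)
        (lp (fun _ : ι => ℂ) 2) :=
      Submodule.sum_mem _ fun i _ => (h1 i).comp_clm (lp.evalCLM ℂ (fun _ : ι => ℂ) 2 i)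
    exact h2
  refine isCompactOperator_of_tendsto (l := (atTop : Filter (Finset ι))) (F := F) ?_
    (Eventually.of_forall hFcompact)
  rw [Metric.tendsto_atTop]
  intro ε hε
  have hfin : {i | ¬ ‖a i‖ < ε / 2}.Finite :=
    (tendsto_zero_iff_norm_tendsto_zero.mp h0).eventually (gt_mem_nhds (half_pos hε))
  refine ⟨hfin.toFinset, fun s hs => ?_⟩
  rw [dist_eq_norm]
  refine lt_of_le_of_lt (ContinuousLinearMap.opNorm_le_bound _ (half_pos hε).le fun x => ?_)
    (half_lt_self hε)
  have hx : ‖((ε / 2 : ℝ) : ℂ) • x‖ = ε / 2 * ‖x‖ := by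
    rw [norm_smul, Complex.norm_real, Real.norm_of_nonneg (half_pos hε).le]
  rw [← hx]
  refine lp.norm_mono two_ne_zero fun i => ?_
  have e1 : (F s - diagonalOp a hC ha) x i = F s x i - a i * x i := by
    rw [sub_apply, lp.coeFn_sub, Pi.sub_apply, diagonalOp_apply]
  rw [e1, hFapply, lp.coeFn_smul, Pi.smul_apply, norm_smul, Complex.norm_real,
    Real.norm_of_nonneg (half_pos hε).le]
  split_ifs with hi
  · simp only [sub_self, norm_zero]
    positivity
  · rw [zero_sub, norm_neg, norm_mul]
    have : ‖a i‖ < ε / 2 := by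
      by_contra h
      exact hi (hs (hfin.mem_toFinset.mpr h))
    gcongr

theorem diagonalOp_inner {ι : Type*} (a : ι → ℝ) {C : ℝ} (hC : 0 ≤ C)
    (ha : ∀ i, ‖(a i : ℂ)‖ ≤ C) (x y : lp (fun _ : ι => ℂ) 2) :
    ⟪diagonalOp (fun i => (a i : ℂ)) hC ha x, y⟫_ℂ =
      ⟪x, diagonalOp (fun i => (a i : ℂ)) hC ha y⟫_ℂ := by
  rw [lp.inner_eq_tsum, lp.inner_eq_tsum]
  refine tsum_congr fun i => ?_
  simp only [diagonalOp_apply, RCLike.inner_apply, map_mul, Complex.conj_ofReal]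
  ring

theorem freqSq_nonneg {d : ℕ} (k : Fin d → ℤ) : 0 ≤ freqSq k :=
  Finset.sum_nonneg fun _ _ => sq_nonneg _

theorem tendsto_freqSq {d : ℕ} : Tendsto (freqSq (d := d)) cofinite atTop := by
  refine tendsto_atTop.mpr fun b => ?_
  -- The bound `m > 1` gives `m ≤ m²`, so `(k i)² < b < m` implies `|k i| ≤ m` and `k` lies in a
  -- finite box.
  obtain ⟨m, hm⟩ := exists_nat_gt (max b 1)
  have h1 : (1 : ℝ) < m := lt_of_le_of_lt (le_max_right _ _) hm
  have h2 : b < m := lt_of_le_of_lt (le_max_left _ _) hm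
  refine (Set.finite_Icc (fun _ : Fin d => -(m : ℤ)) (fun _ => (m : ℤ))).subset ?_
  intro k hk
  have hk' : freqSq k < b := not_le.mp hk
  have hki : ∀ i, |k i| ≤ (m : ℤ) := by
    intro i
    have h3 : (k i : ℝ) ^ 2 ≤ freqSq k :=
      Finset.single_le_sum (f := fun i => (k i : ℝ) ^ 2) (fun _ _ => sq_nonneg _)
        (Finset.mem_univ i)
    have h4 : |(k i : ℝ)| ≤ m := abs_le_of_sq_le_sq (by nlinarith) (by linarith)
    exact_mod_cast h4
  exact ⟨fun i => (abs_le.mp (hki i)).1, fun i => (abs_le.mp (hki i)).2⟩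

theorem fourierCoef_ext {d : ℕ} {u v : H0 d} (h : ∀ k, fourierCoef u k = fourierCoef v k) :
    u = v := by
  apply (fourierBasis d).repr.injective
  ext k
  simpa only [fourierCoef_eq_repr] using h k

theorem fourierCoef_symm {d : ℕ} (x : lp (fun _ : Fin d → ℤ => ℂ) 2) (k : Fin d → ℤ) :
    fourierCoef ((fourierBasis d).repr.symm x) k = x k := by
  rw [fourierCoef_eq_repr, LinearIsometryEquiv.apply_symm_apply]

/-- `-Δ` as a linear map on `H²`. -/
def negLaplacianMap (d : ℕ) : H2 d →ₗ[ℂ] H0 d := (negLaplacian d).toFun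

/-- `-Δ + K` as a linear map on `H²`. -/
def schrodingerMap {d : ℕ} (K : H0 d →L[ℂ] H0 d) : H2 d →ₗ[ℂ] H0 d := (schrodinger K).toFun

theorem fourierCoef_negLaplacian {d : ℕ} (u : H2 d) (k : Fin d → ℤ) :
    fourierCoef (negLaplacianMap d u) k =
      ((4 * Real.pi ^ 2 * freqSq k : ℝ) : ℂ) * fourierCoef (u : H0 d) k :=
  fourierCoef_symm _ k

/-- For `c > 0`, the resolvent `D = (-Δ + c)⁻¹` is compact and selfadjoint, with norm at most
`c⁻¹`. -/
theorem exists_resolvent_negLaplacian (d : ℕ) {c : ℝ} (hc : 0 < c) :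
    ∃ D : H0 d →L[ℂ] H0 d, IsCompactOperator D ∧ IsSelfAdjoint D ∧ ‖D‖ ≤ c⁻¹ ∧
      (∀ f, ∃ h : D f ∈ H2 d, negLaplacianMap d ⟨D f, h⟩ + (c : ℂ) • D f = f) ∧
      ∀ u : H2 d, D (negLaplacianMap d u + (c : ℂ) • (u : H0 d)) = u := by
  let m : (Fin d → ℤ) → ℝ := fun k => 4 * Real.pi ^ 2 * freqSq k + c
  have hpi : 0 < 4 * Real.pi ^ 2 := by positivity
  have hm : ∀ k, c ≤ m k := fun k => by
    have := mul_nonneg hpi.le (freqSq_nonneg k)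
    simp only [m]; linarith
  have hmpos : ∀ k, 0 < m k := fun k => hc.trans_le (hm k)
  have hbd : ∀ k, ‖(((m k)⁻¹ : ℝ) : ℂ)‖ ≤ c⁻¹ := fun k => by
    rw [Complex.norm_real, Real.norm_of_nonneg (inv_pos.mpr (hmpos k)).le]
    exact inv_anti₀ hc (hm k)
  let E := diagonalOp (fun k => (((m k)⁻¹ : ℝ) : ℂ)) (inv_pos.mpr hc).le hbd
  let U := (fourierBasis d).repr
  let D : H0 d →L[ℂ] H0 d :=
    (U.symm.toContinuousLinearEquiv : _ →L[ℂ] H0 d) ∘L E ∘L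
      (U.toContinuousLinearEquiv : H0 d →L[ℂ] _)
  have hDapply : ∀ f, D f = U.symm (E (U f)) := fun f => rfl
  have hDcoef : ∀ f k, fourierCoef (D f) k = (((m k)⁻¹ : ℝ) : ℂ) * fourierCoef f k := by
    intro f k
    rw [hDapply, fourierCoef_symm, diagonalOp_apply, fourierCoef_eq_repr]
  have hmne : ∀ k, ((m k : ℝ) : ℂ) ≠ 0 := fun k => by exact_mod_cast (hmpos k).ne'
  have hmul : ∀ k (z : ℂ), ((4 * Real.pi ^ 2 * freqSq k : ℝ) : ℂ) * z + (c : ℂ) * z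
      = (m k : ℂ) * z := by
    intro k z
    simp only [m]; push_cast; ring
  refine ⟨D, ?_, ?_, ?_, ?_, ?_⟩
  · have hE : IsCompactOperator E := by
      refine isCompactOperator_diagonalOp _ _ _ ?_
      have h1 : Tendsto m cofinite atTop :=
        tendsto_atTop_add_const_right _ _ (tendsto_freqSq.const_mul_atTop hpi)
      have h2 := (Complex.continuous_ofReal.tendsto 0).comp (tendsto_inv_atTop_zero.comp h1)
      rw [Complex.ofReal_zero] at h2
      exact h2
    exact (hE.comp_clm (U.toContinuousLinearEquiv : H0 d →L[ℂ] _)).clm_comp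
      (U.symm.toContinuousLinearEquiv : _ →L[ℂ] H0 d)
  · rw [ContinuousLinearMap.isSelfAdjoint_iff_isSymmetric]
    intro f g
    change ⟪U.symm (E (U f)), g⟫_ℂ = ⟪f, U.symm (E (U g))⟫_ℂ
    rw [← U.inner_map_map, ← U.inner_map_map f, U.apply_symm_apply, U.apply_symm_apply]
    exact diagonalOp_inner _ _ _ _ _
  · refine ContinuousLinearMap.opNorm_le_bound _ (inv_pos.mpr hc).le fun f => ?_
    rw [hDapply, LinearIsometryEquiv.norm_map]
    refine (E.le_opNorm _).trans ?_
    rw [LinearIsometryEquiv.norm_map]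
    gcongr
    exact norm_diagonalOp_le _ _ _
  · intro f
    have h : D f ∈ H2 d := by
      -- The constant bounds `(1 + |k|²) / m k`, since `|k|² ≤ m k / (4π²)` and `1 ≤ m k / c`.
      have h0 : Memℓp (fun k => (1 / (4 * Real.pi ^ 2) + c⁻¹) * ‖U f k‖) 2 :=
        (lp.memℓp (U f)).norm.const_mul _
      refine h0.mono fun k => ?_
      rw [hDcoef, norm_mul, norm_mul, fourierCoef_eq_repr, ← mul_assoc]
      refine mul_le_mul_of_nonneg_right ?_ (norm_nonneg _)
      rw [Complex.norm_real, Complex.norm_real, Real.norm_of_nonneg (inv_pos.mpr (hmpos k)).le,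
        Real.norm_of_nonneg (by have := freqSq_nonneg k; linarith), ← div_eq_mul_inv,
        div_le_iff₀ (hmpos k)]
      have e : (1 / (4 * Real.pi ^ 2) + c⁻¹) * m k =
          freqSq k + 1 + (1 / (4 * Real.pi ^ 2) * c + c⁻¹ * (4 * Real.pi ^ 2 * freqSq k)) := by
        simp only [m]; field_simp; ring
      have := freqSq_nonneg k
      rw [e]
      have : 0 ≤ 1 / (4 * Real.pi ^ 2) * c + c⁻¹ * (4 * Real.pi ^ 2 * freqSq k) := by positivity
      linarith
    refine ⟨h, fourierCoef_ext fun k => ?_⟩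
    rw [fourierCoef_add, fourierCoef_smul, fourierCoef_negLaplacian, hmul, hDcoef,
      ← mul_assoc, Complex.ofReal_inv, mul_inv_cancel₀ (hmne k), one_mul]
  · intro u
    refine fourierCoef_ext fun k => ?_
    rw [hDcoef, fourierCoef_add, fourierCoef_smul, fourierCoef_negLaplacian, hmul,
      ← mul_assoc, Complex.ofReal_inv, inv_mul_cancel₀ (hmne k), one_mul]

/-! ### Compact resolvents of Schrödinger operators. -/

/-- `R = (-Δ + K + c)⁻¹` as a bounded operator. -/
structure IsShiftedInverse {d : ℕ} (K : H0 d →L[ℂ] H0 d) (c : ℝ) (R : H0 d →L[ℂ] H0 d) :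
    Prop where
  compact : IsCompactOperator R
  selfAdjoint : IsSelfAdjoint R
  right_inv : ∀ f, ∃ h : R f ∈ H2 d, schrodingerMap K ⟨R f, h⟩ + (c : ℂ) • R f = f
  left_inv : ∀ u : H2 d, R (schrodingerMap K u + (c : ℂ) • (u : H0 d)) = u

theorem schrodingerMap_apply {d : ℕ} (K : H0 d →L[ℂ] H0 d) (u : H2 d) :
    schrodingerMap K u = negLaplacianMap d u + K u := rfl

/-- With `D = (-Δ + c)⁻¹`, one has `-Δ + K + c = (1 + K D)(-Δ + c)`. For `c = ‖K‖ + 1` the norm of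
`K D` is below 1, so a Neumann series inverts `S = 1 + K D`, and `R = D S⁻¹`. -/
theorem exists_isShiftedInverse {d : ℕ} {K : H0 d →L[ℂ] H0 d} (hK : IsSelfAdjoint K) :
    ∃ c R, IsShiftedInverse K c R := by
  have hc : 0 < ‖K‖ + 1 := by positivity
  obtain ⟨D, hDc, hDs, hDn, hDr, hDl⟩ := exists_resolvent_negLaplacian d hc
  have hn : ‖-(K * D)‖ < 1 := by
    rw [norm_neg]
    calc ‖K * D‖ ≤ ‖K‖ * ‖D‖ := norm_mul_le _ _
      _ ≤ ‖K‖ * (‖K‖ + 1)⁻¹ := by gcongr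
      _ < 1 := by rw [← div_eq_mul_inv, div_lt_one hc]; linarith
  have hunit : IsUnit (1 + K * D) := by
    simpa using (Units.oneSub _ hn).isUnit
  obtain ⟨S, hS⟩ := hunit
  have hS1 : ∀ f, (S⁻¹ : (H0 d →L[ℂ] H0 d)ˣ).1 f + K (D ((S⁻¹ : (H0 d →L[ℂ] H0 d)ˣ).1 f)) = f := by
    intro f
    have h := congrArg (fun T : H0 d →L[ℂ] H0 d => T f) S.mul_inv
    rw [hS] at h
    simpa using h
  have hS2 : ∀ f, (S⁻¹ : (H0 d →L[ℂ] H0 d)ˣ).1 (f + K (D f)) = f := by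
    intro f
    have h := congrArg (fun T : H0 d →L[ℂ] H0 d => T f) S.inv_mul
    rw [hS] at h
    simpa using h
  refine ⟨‖K‖ + 1, D * (S⁻¹ : (H0 d →L[ℂ] H0 d)ˣ).1, hDc.comp_clm _, ?_, ?_, ?_⟩
  · have hstar : star S.1 * D = D * S.1 := by
      rw [hS, star_add, star_mul, hK.star_eq, hDs.star_eq, star_one]
      noncomm_ring
    have h2 : star (S⁻¹ : (H0 d →L[ℂ] H0 d)ˣ).1 * star S.1 = 1 := by
      rw [← star_mul, S.mul_inv, star_one]
    rw [isSelfAdjoint_iff, star_mul, hDs.star_eq]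
    calc star (S⁻¹ : (H0 d →L[ℂ] H0 d)ˣ).1 * D
        = star (S⁻¹ : (H0 d →L[ℂ] H0 d)ˣ).1 * (D * S.1) * (S⁻¹ : (H0 d →L[ℂ] H0 d)ˣ).1 := by
          rw [mul_assoc, mul_assoc D, S.mul_inv, mul_one]
      _ = D * (S⁻¹ : (H0 d →L[ℂ] H0 d)ˣ).1 := by
          rw [← hstar, ← mul_assoc, h2, one_mul]
  · intro f
    obtain ⟨h, e⟩ := hDr ((S⁻¹ : (H0 d →L[ℂ] H0 d)ˣ).1 f)
    refine ⟨h, ?_⟩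
    rw [schrodingerMap_apply, add_right_comm]
    exact (congrArg (· + K (D ((S⁻¹ : (H0 d →L[ℂ] H0 d)ˣ).1 f))) e).trans (hS1 f)
  · intro u
    set g := negLaplacianMap d u + ((‖K‖ + 1 : ℝ) : ℂ) • (u : H0 d) with hg
    have hDg : D g = u := hDl u
    have e : schrodingerMap K u + ((‖K‖ + 1 : ℝ) : ℂ) • (u : H0 d) = g + K (D g) := by
      rw [hDg, schrodingerMap_apply, hg, add_right_comm]
    rw [e]
    change D ((S⁻¹ : (H0 d →L[ℂ] H0 d)ˣ).1 _) = _
    rw [hS2, hDg]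


/-! ### Completeness and invariance of the spans of eigenvectors. -/

/-- The eigenvectors of `-Δ + K` are complete. -/
theorem top_le_closure_iSup_firstSpan {d : ℕ} {K R : H0 d →L[ℂ] H0 d} {c : ℝ}
    (hR : IsShiftedInverse K c R) {α : ℕ → ℝ} {v : ℕ → H2 d}
    (hv : IsEigenEnumeration (schrodinger K) α v) :
    ⊤ ≤ (⨆ n, firstSpan v n).topologicalClosure := by
  have hRs : (R : H0 d →ₗ[ℂ] H0 d).IsSymmetric :=
    (ContinuousLinearMap.isSelfAdjoint_iff_isSymmetric.mp hR.selfAdjoint)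
  refine ((Submodule.topologicalClosure_eq_top_iff).mpr ?_).ge
  -- By the spectral theorem for the compact symmetric `R`, it is enough that every eigenvector of
  -- `R` lies in some `firstSpan v n`.
  rw [eq_bot_iff, ← ContinuousLinearMap.orthogonalComplement_iSup_eigenspaces_eq_bot hR.compact hRs]
  refine Submodule.orthogonal_le (iSup_le fun μ u hu => ?_)
  have hRu : R u = μ • u := Module.End.mem_eigenspace_iff.mp hu
  rcases eq_or_ne u 0 with rfl | hu0
  · exact zero_mem _
  have hμ : μ ≠ 0 := by
    rintro rfl
    obtain ⟨h, e⟩ := hR.right_inv u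
    rw [zero_smul] at hRu
    have h0 : (⟨R u, h⟩ : H2 d) = 0 := Subtype.ext hRu
    rw [h0, map_zero, hRu, smul_zero, add_zero] at e
    exact hu0 e.symm
  have hμr : (starRingEnd ℂ) μ = μ :=
    hRs.conj_eigenvalue_eq_self (Module.End.hasEigenvalue_of_hasEigenvector ⟨hu, hu0⟩)
  obtain ⟨r, rfl⟩ := Complex.conj_eq_iff_real.mp hμr
  have hRf : R ((r : ℂ)⁻¹ • u) = u := by rw [map_smul, hRu, inv_smul_smul₀ hμ]
  obtain ⟨h, e⟩ := hR.right_inv ((r : ℂ)⁻¹ • u)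
  have hmem : u ∈ H2 d := hRf ▸ h
  have h0 : (⟨R ((r : ℂ)⁻¹ • u), h⟩ : H2 d) = ⟨u, hmem⟩ := Subtype.ext hRf
  rw [h0, hRf] at e
  -- An eigenvalue `r` of `R` corresponds to the eigenvalue `r⁻¹ - c` of `-Δ + K`, to which
  -- `exhaustive` applies.
  have e2 : schrodingerMap K ⟨u, hmem⟩ = ((r⁻¹ - c : ℝ) : ℂ) • u := by
    rw [eq_sub_of_add_eq e, Complex.ofReal_sub, sub_smul, Complex.ofReal_inv]
  refine Submodule.span_le.mpr ?_ (hv.exhaustive _ ⟨u, hmem⟩ e2)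
  rintro _ ⟨i, -, rfl⟩
  exact Submodule.mem_iSup_of_mem (i + 1)
    (Submodule.subset_span ⟨(⟨i, Nat.lt_succ_self i⟩ : Fin (i + 1)), rfl⟩)

theorem firstSpan_mono {d : ℕ} (v : ℕ → H2 d) : Monotone (firstSpan v) := by
  intro m n hmn
  refine Submodule.span_mono ?_
  rintro _ ⟨i, rfl⟩
  exact ⟨Fin.castLE hmn i, rfl⟩

theorem tendsto_starProjection_firstSpan {d : ℕ} {K : H0 d →L[ℂ] H0 d} {R : H0 d →L[ℂ] H0 d}
    {c : ℝ} (hR : IsShiftedInverse K c R) {α : ℕ → ℝ} {v : ℕ → H2 d}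
    (hv : IsEigenEnumeration (schrodinger K) α v) (x : H0 d) :
    Tendsto (fun n => (firstSpan v n).starProjection x) atTop (𝓝 x) :=
  Submodule.starProjection_tendsto_self _ (firstSpan_mono v) x
    (top_le_closure_iSup_firstSpan hR hv)

theorem schrodingerMap_mem_firstSpan {d : ℕ} {K : H0 d →L[ℂ] H0 d} {α : ℕ → ℝ} {v : ℕ → H2 d}
    (hv : IsEigenEnumeration (schrodinger K) α v) {n : ℕ} {u : H0 d} (hu : u ∈ firstSpan v n)
    (h : u ∈ H2 d) : schrodingerMap K ⟨u, h⟩ ∈ firstSpan v n := by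
  -- The operator acts only on `H2`, so the span is lifted there before linearity is used.
  have key : firstSpan v n = (Submodule.span ℂ (Set.range fun i : Fin n => v i)).map
      (H2 d).subtype := by
    rw [Submodule.map_span, ← Set.range_comp]
    rfl
  rw [key] at hu
  obtain ⟨x, hx, rfl⟩ := hu
  have hle : Submodule.span ℂ (Set.range fun i : Fin n => v i) ≤
      (firstSpan v n).comap (schrodingerMap K) := by
    refine Submodule.span_le.mpr ?_
    rintro _ ⟨i, rfl⟩
    have e : schrodingerMap K (v i) = (α i : ℂ) • (v i : H0 d) := hv.apply_eq i
    change schrodingerMap K (v i) ∈ firstSpan v n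
    rw [e]
    exact Submodule.smul_mem _ _ (Submodule.subset_span ⟨i, rfl⟩)
  exact hle hx

/-- `Pₙ (-Δ + K) u = (-Δ + K⁰) u + Pₙ (K - K⁰) u` for `u` in the range of `Pₙ`, when `Pₙ` is a
spectral projection of `-Δ + K⁰`. -/
theorem coe_truncSchrodinger {d : ℕ} {K₀ : H0 d →L[ℂ] H0 d} (K : H0 d →L[ℂ] H0 d) {α : ℕ → ℝ}
    {v : ℕ → H2 d} (hv : IsEigenEnumeration (schrodinger K₀) α v) {n : ℕ} (u : firstSpan v n) :
    (truncSchrodinger K v n u : H0 d) = schrodingerMap K₀ ⟨u, firstSpan_le v n u.2⟩ +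
      (firstSpan v n).starProjection ((K - K₀) u) := by
  have h1 : (truncSchrodinger K v n u : H0 d) =
      (firstSpan v n).starProjection (schrodingerMap K ⟨u, firstSpan_le v n u.2⟩) := rfl
  have h2 : schrodingerMap K ⟨u, firstSpan_le v n u.2⟩ =
      schrodingerMap K₀ ⟨u, firstSpan_le v n u.2⟩ + (K - K₀) u := by
    rw [schrodingerMap_apply, schrodingerMap_apply, sub_apply]
    abel
  rw [h1, h2, map_add, Submodule.starProjection_eq_self_iff.mpr
    (schrodingerMap_mem_firstSpan hv u.2 _)]

/-! ### Passage to the limit by compactness. -/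

section Limit

variable {E : Type*} [NormedAddCommGroup E] [InnerProductSpace ℂ E]

theorem tendsto_apply_of_bounded {B : ℕ → E →L[ℂ] E} {B₀ : E →L[ℂ] E} {C : ℝ}
    (hC : ∀ j, ‖B j‖ ≤ C) (hB : ∀ u, Tendsto (fun j => B j u) atTop (𝓝 (B₀ u)))
    {x : ℕ → E} {x₀ : E} (hx : Tendsto x atTop (𝓝 x₀)) :
    Tendsto (fun j => B j (x j)) atTop (𝓝 (B₀ x₀)) := by
  have h1 : Tendsto (fun j => B j (x j - x₀)) atTop (𝓝 0) := by
    refine squeeze_zero_norm (fun j => (B j).le_of_opNorm_le (hC j) _) ?_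
    simpa using (tendsto_iff_norm_sub_tendsto_zero.mp hx).const_mul C
  simpa using h1.add (hB x₀)

/-- Symmetry gives `⟪p j, y⟫ = ⟪g j, R y⟫`, so weak convergence of `g` identifies the limit of `p`.
-/
theorem eq_apply_of_weak_limit {R : E →L[ℂ] E} (hR : (R : E →ₗ[ℂ] E).IsSymmetric)
    {p g : ℕ → E} {p₀ g₀ : E} (hpg : ∀ j, p j = R (g j)) (hp : Tendsto p atTop (𝓝 p₀))
    (hg : ∀ y, Tendsto (fun j => ⟪g j, y⟫_ℂ) atTop (𝓝 ⟪g₀, y⟫_ℂ)) : p₀ = R g₀ := by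
  refine ext_inner_right ℂ fun y => ?_
  have h1 : Tendsto (fun j => ⟪p j, y⟫_ℂ) atTop (𝓝 ⟪p₀, y⟫_ℂ) := hp.inner tendsto_const_nhds
  have h2 : ∀ j, ⟪p j, y⟫_ℂ = ⟪g j, R y⟫_ℂ := fun j => by rw [hpg]; exact hR _ _
  simp only [h2] at h1
  exact (tendsto_nhds_unique h1 (hg (R y))).trans (hR _ _).symm

theorem exists_subseq_tendsto_of_compact {R₁ R₂ : E →L[ℂ] E} (h₁ : IsCompactOperator R₁)
    (h₂ : IsCompactOperator R₂) {g₁ g₂ : ℕ → E} {C : ℝ} (hg₁ : ∀ j, ‖g₁ j‖ ≤ C)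
    (hg₂ : ∀ j, ‖g₂ j‖ ≤ C) :
    ∃ x y, ∃ φ : ℕ → ℕ, StrictMono φ ∧ Tendsto (fun j => R₁ (g₁ (φ j))) atTop (𝓝 x) ∧
      Tendsto (fun j => R₂ (g₂ (φ j))) atTop (𝓝 y) := by
  obtain ⟨S₁, hS₁, hsub₁⟩ := h₁.image_closedBall_subset_compact (f := (R₁ : E →ₗ[ℂ] E)) C
  obtain ⟨S₂, hS₂, hsub₂⟩ := h₂.image_closedBall_subset_compact (f := (R₂ : E →ₗ[ℂ] E)) C
  obtain ⟨⟨x, y⟩, -, φ, hφ, hlim⟩ := (hS₁.prod hS₂).tendsto_subseq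
    (x := fun j => (R₁ (g₁ j), R₂ (g₂ j))) fun j =>
      ⟨hsub₁ ⟨g₁ j, by simpa using hg₁ j, rfl⟩, hsub₂ ⟨g₂ j, by simpa using hg₂ j, rfl⟩⟩
  exact ⟨x, y, φ, hφ, (continuous_fst.tendsto _).comp hlim, (continuous_snd.tendsto _).comp hlim⟩

/-- Normalised solutions of approximating fixed point equations with compact resolvents accumulate
at a nonzero solution of the limiting equations. -/
theorem exists_limit_solution [CompleteSpace E] {R₁ R₂ : E →L[ℂ] E}
    (hR₁ : IsCompactOperator R₁) (hR₂ : IsCompactOperator R₂)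
    (hs₁ : IsSelfAdjoint R₁) (hs₂ : IsSelfAdjoint R₂) (a b : ℂ)
    {P Q L₁ L₂ B : ℕ → E →L[ℂ] E} {B₀ : E →L[ℂ] E} {C : ℝ}
    (hPn : ∀ j, ‖P j‖ ≤ 1) (hQn : ∀ j, ‖Q j‖ ≤ 1)
    (hQs : ∀ j, (Q j : E →ₗ[ℂ] E).IsSymmetric)
    (hL₁n : ∀ j, ‖L₁ j‖ ≤ C) (hL₂n : ∀ j, ‖L₂ j‖ ≤ C) (hBn : ∀ j, ‖B j‖ ≤ C)
    (hP : ∀ u, Tendsto (fun j => P j u) atTop (𝓝 u))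
    (hQ : ∀ u, Tendsto (fun j => Q j u) atTop (𝓝 u))
    (hL₁ : ∀ u, Tendsto (fun j => L₁ j u) atTop (𝓝 0))
    (hL₂ : ∀ u, Tendsto (fun j => L₂ j u) atTop (𝓝 0))
    (hB : ∀ u, Tendsto (fun j => B j u) atTop (𝓝 (B₀ u)))
    {p q : ℕ → E} (hnorm : ∀ j, ‖(p j, q j)‖ = 1)
    (hp : ∀ j, p j = R₁ (a • p j - P j (L₁ j (p j)) - P j (B j (q j))))
    (hq : ∀ j, q j = R₂ (b • q j - Q j (L₂ j (q j)) +
      Q j (ContinuousLinearMap.adjoint (B j) (p j)))) :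
    ∃ x y : E, (x, y) ≠ 0 ∧ x = R₁ (a • x - B₀ y) ∧
      y = R₂ (b • y + ContinuousLinearMap.adjoint B₀ x) := by
  have hpn : ∀ j, ‖p j‖ ≤ 1 := fun j => (norm_fst_le (p j, q j)).trans_eq (hnorm j)
  have hqn : ∀ j, ‖q j‖ ≤ 1 := fun j => (norm_snd_le (p j, q j)).trans_eq (hnorm j)
  have hbd : ∀ (T S : E →L[ℂ] E) (u : E), ‖T‖ ≤ 1 → ‖S‖ ≤ C → ‖u‖ ≤ 1 → ‖T (S u)‖ ≤ C := by
    intro T S u hT hS hu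
    have h1 := T.le_of_opNorm_le hT (S u)
    have h2 := S.le_of_opNorm_le_of_le hS hu
    linarith
  have hsm : ∀ (z : ℂ) (u : E), ‖u‖ ≤ 1 → ‖z • u‖ ≤ ‖z‖ := fun z u hu => by
    rw [norm_smul]
    exact mul_le_of_le_one_right (norm_nonneg _) hu
  -- The bound is chosen to serve both components, so that one radius fits both compactness
  -- arguments.
  have hg₁ : ∀ j, ‖a • p j - P j (L₁ j (p j)) - P j (B j (q j))‖ ≤ ‖a‖ + ‖b‖ + C + C := by
    intro j
    have h1 := norm_sub_le (a • p j - P j (L₁ j (p j))) (P j (B j (q j)))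
    have h2 := norm_sub_le (a • p j) (P j (L₁ j (p j)))
    have h3 := hbd _ _ _ (hPn j) (hL₁n j) (hpn j)
    have h4 := hbd _ _ _ (hPn j) (hBn j) (hqn j)
    have h5 := hsm a _ (hpn j)
    have h6 := norm_nonneg b
    linarith
  have hg₂ : ∀ j, ‖b • q j - Q j (L₂ j (q j)) +
      Q j (ContinuousLinearMap.adjoint (B j) (p j))‖ ≤ ‖a‖ + ‖b‖ + C + C := by
    intro j
    have h1 := norm_add_le (b • q j - Q j (L₂ j (q j)))
      (Q j (ContinuousLinearMap.adjoint (B j) (p j)))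
    have h2 := norm_sub_le (b • q j) (Q j (L₂ j (q j)))
    have h3 := hbd _ _ _ (hQn j) (hL₂n j) (hqn j)
    have h4 := hbd _ (ContinuousLinearMap.adjoint (B j)) _ (hQn j)
      ((LinearIsometryEquiv.norm_map _ _).trans_le (hBn j)) (hpn j)
    have h5 := hsm b _ (hqn j)
    have h6 := norm_nonneg a
    linarith
  obtain ⟨x, y, φ, hφ, hx, hy⟩ := exists_subseq_tendsto_of_compact hR₁ hR₂ hg₁ hg₂
  simp only [← hp] at hx
  simp only [← hq] at hy
  have hφt := hφ.tendsto_atTop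
  have hPφ : ∀ {u : ℕ → E} {u₀ : E}, Tendsto u atTop (𝓝 u₀) →
      Tendsto (fun j => P (φ j) (u j)) atTop (𝓝 u₀) := fun hu =>
    tendsto_apply_of_bounded (B₀ := ContinuousLinearMap.id ℂ E) (fun j => hPn (φ j))
      (fun u => (hP u).comp hφt) hu
  have hQφ : ∀ {u : ℕ → E} {u₀ : E}, Tendsto u atTop (𝓝 u₀) →
      Tendsto (fun j => Q (φ j) (u j)) atTop (𝓝 u₀) := fun hu =>
    tendsto_apply_of_bounded (B₀ := ContinuousLinearMap.id ℂ E) (fun j => hQn (φ j))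
      (fun u => (hQ u).comp hφt) hu
  have hBφ : ∀ {u : ℕ → E} {u₀ : E}, Tendsto u atTop (𝓝 u₀) →
      Tendsto (fun j => B (φ j) (u j)) atTop (𝓝 (B₀ u₀)) := fun hu =>
    tendsto_apply_of_bounded (fun j => hBn (φ j)) (fun u => (hB u).comp hφt) hu
  have hL₁φ : Tendsto (fun j => L₁ (φ j) (p (φ j))) atTop (𝓝 0) :=
    tendsto_apply_of_bounded (B₀ := 0) (fun j => hL₁n (φ j)) (fun u => (hL₁ u).comp hφt) hx
  have hL₂φ : Tendsto (fun j => L₂ (φ j) (q (φ j))) atTop (𝓝 0) :=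
    tendsto_apply_of_bounded (B₀ := 0) (fun j => hL₂n (φ j)) (fun u => (hL₂ u).comp hφt) hy
  refine ⟨x, y, ?_, ?_, ?_⟩
  -- Convergence is in norm, so the limit still has norm 1.
  · intro h0
    have h1 : Tendsto (fun j => ‖(p (φ j), q (φ j))‖) atTop (𝓝 ‖(x, y)‖) :=
      (hx.prodMk_nhds hy).norm
    simp only [hnorm] at h1
    rw [h0, norm_zero] at h1
    exact one_ne_zero (tendsto_nhds_unique tendsto_const_nhds h1)
  · refine eq_apply_of_weak_limit (ContinuousLinearMap.isSelfAdjoint_iff_isSymmetric.mp hs₁)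
      (fun j => hp (φ j)) hx fun z => ?_
    have h1 := ((hx.const_smul a).sub (hPφ hL₁φ)).sub (hPφ (hBφ hy))
    rw [sub_zero] at h1
    exact h1.inner tendsto_const_nhds
  · refine eq_apply_of_weak_limit (ContinuousLinearMap.isSelfAdjoint_iff_isSymmetric.mp hs₂)
      (fun j => hq (φ j)) hy fun z => ?_
    have h1 := (hy.const_smul b).sub (hQφ hL₂φ)
    rw [sub_zero] at h1
    -- The adjoints need not converge strongly; moving `Q` and `B` onto the fixed vector `z` uses
    -- only the strong convergence of `B`.
    have h2 : Tendsto (fun j => ⟪Q (φ j) (ContinuousLinearMap.adjoint (B (φ j)) (p (φ j))), z⟫_ℂ)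
        atTop (𝓝 ⟪ContinuousLinearMap.adjoint B₀ x, z⟫_ℂ) := by
      have e : ∀ j, ⟪Q (φ j) (ContinuousLinearMap.adjoint (B (φ j)) (p (φ j))), z⟫_ℂ =
          ⟪p (φ j), B (φ j) (Q (φ j) z)⟫_ℂ := fun j =>
        (hQs (φ j) _ _).trans (ContinuousLinearMap.adjoint_inner_left _ _ _)
      simp only [e, ContinuousLinearMap.adjoint_inner_left]
      exact hx.inner (hBφ (hQφ tendsto_const_nhds))
    simp only [inner_add_left]
    exact (h1.inner tendsto_const_nhds).add h2

end Limit

/-! ### Fixed point equations for the truncated and the limiting block operators. -/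

/-- An eigenvector of the truncated block operator satisfies fixed point equations for the
resolvents of the unperturbed diagonal blocks. -/
theorem eq_of_truncBlockOp_apply {d : ℕ} {K₁ K₂ R₁ R₂ : H0 d →L[ℂ] H0 d} {c₁ c₂ : ℝ}
    (hR₁ : IsShiftedInverse K₁ c₁ R₁) (hR₂ : IsShiftedInverse K₂ c₂ R₂) {α β : ℕ → ℝ}
    {v w : ℕ → H2 d} (hv : IsEigenEnumeration (schrodinger K₁) α v)
    (hw : IsEigenEnumeration (schrodinger K₂) β w) (K₁' K₂' K : H0 d →L[ℂ] H0 d) {σ : ℂ} {n : ℕ}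
    {p : firstSpan v n} {q : firstSpan w n}
    (h : truncBlockOp K₁' K₂' K v w n (p, q) = σ • (p, q)) :
    (p : H0 d) = R₁ ((c₁ + σ) • (p : H0 d) - (firstSpan v n).starProjection ((K₁' - K₁) p) -
      (firstSpan v n).starProjection (K q)) ∧
    (q : H0 d) = R₂ ((c₂ - σ) • (q : H0 d) - (firstSpan w n).starProjection ((K₂' - K₂) q) +
      (firstSpan w n).starProjection (ContinuousLinearMap.adjoint K p)) := by
  have h1 : (truncSchrodinger K₁' v n p : H0 d) + (firstSpan v n).starProjection (K q) =
      σ • (p : H0 d) := congrArg (fun z => (z.1 : H0 d)) h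
  have h2 : (firstSpan w n).starProjection (ContinuousLinearMap.adjoint K p) -
      (truncSchrodinger K₂' w n q : H0 d) = σ • (q : H0 d) := congrArg (fun z => (z.2 : H0 d)) h
  rw [coe_truncSchrodinger K₁' hv] at h1
  rw [coe_truncSchrodinger K₂' hw] at h2
  constructor
  · refine (hR₁.left_inv ⟨p, firstSpan_le v n p.2⟩).symm.trans (congrArg R₁ ?_)
    rw [add_smul, ← h1]
    abel
  · refine (hR₂.left_inv ⟨q, firstSpan_le w n q.2⟩).symm.trans (congrArg R₂ ?_)
    rw [sub_smul, ← h2]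
    abel

/-- If `σ` is in the resolvent set of the block operator, the limiting fixed point equations have
only the trivial solution. -/
theorem eq_zero_of_mem_unboundedResolventSet {d : ℕ} {K₁ K₂ K R₁ R₂ : H0 d →L[ℂ] H0 d} {c₁ c₂ : ℝ}
    (hR₁ : IsShiftedInverse K₁ c₁ R₁) (hR₂ : IsShiftedInverse K₂ c₂ R₂) {σ : ℂ}
    (hσ : σ ∈ unboundedResolventSet (blockOp K₁ K₂ K)) {x y : H0 d}
    (hx : x = R₁ ((c₁ + σ) • x - K y))
    (hy : y = R₂ ((c₂ - σ) • y + ContinuousLinearMap.adjoint K x)) : (x, y) = 0 := by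
  obtain ⟨T, -, hT⟩ := hσ
  obtain ⟨h1, e1⟩ := hR₁.right_inv ((c₁ + σ) • x - K y)
  obtain ⟨h2, e2⟩ := hR₂.right_inv ((c₂ - σ) • y + ContinuousLinearMap.adjoint K x)
  have m1 : x ∈ H2 d := hx ▸ h1
  have m2 : y ∈ H2 d := hy ▸ h2
  have s1 : (⟨R₁ ((c₁ + σ) • x - K y), h1⟩ : H2 d) = ⟨x, m1⟩ := Subtype.ext hx.symm
  have s2 : (⟨R₂ ((c₂ - σ) • y + ContinuousLinearMap.adjoint K x), h2⟩ : H2 d) = ⟨y, m2⟩ :=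
    Subtype.ext hy.symm
  rw [s1, ← hx] at e1
  rw [s2, ← hy] at e2
  have f1 : schrodingerMap K₁ ⟨x, m1⟩ + K y = σ • x := by
    rw [eq_sub_of_add_eq e1, add_smul]; abel
  have f2 : ContinuousLinearMap.adjoint K x - schrodingerMap K₂ ⟨y, m2⟩ = σ • y := by
    rw [eq_sub_of_add_eq e2, sub_smul]; abel
  have h3 : blockOp K₁ K₂ K ⟨(x, y), ⟨m1, m2⟩⟩ = σ • (x, y) := Prod.ext f1 f2
  have h4 := hT ⟨(x, y), ⟨m1, m2⟩⟩
  rw [h3, sub_self, map_zero] at h4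
  exact h4.symm

/-- A normalised eigenvector of an operator on a product of finite-dimensional subspaces. -/
theorem exists_normalized_eigenvector {d : ℕ} {v w : ℕ → H2 d} {n : ℕ}
    {T : Module.End ℂ (firstSpan v n × firstSpan w n)} {σ : ℂ} (h : σ ∉ resolventSet ℂ T) :
    ∃ (p : firstSpan v n) (q : firstSpan w n), ‖((p : H0 d), (q : H0 d))‖ = 1 ∧
      T (p, q) = σ • (p, q) := by
  -- In finite dimension every spectral value is an eigenvalue.
  have h1 : Module.End.HasEigenvalue T σ :=
    Module.End.hasEigenvalue_iff_mem_spectrum.mpr h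
  obtain ⟨z, hz⟩ := h1.exists_hasEigenvector
  have hz0 : ‖z‖ ≠ 0 := norm_ne_zero_iff.mpr hz.2
  refine ⟨((‖z‖⁻¹ : ℝ) : ℂ) • z.1, ((‖z‖⁻¹ : ℝ) : ℂ) • z.2, ?_, ?_⟩
  · have e : ‖((‖z‖⁻¹ : ℝ) : ℂ) • z‖ = 1 := by
      rw [norm_smul, Complex.norm_real, norm_inv, norm_norm, inv_mul_cancel₀ hz0]
    exact e
  · change T (((‖z‖⁻¹ : ℝ) : ℂ) • z) = σ • ((‖z‖⁻¹ : ℝ) : ℂ) • z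
    rw [map_smul, hz.apply_eq_smul, smul_comm]

theorem IsBoundedStronglyContinuous.tendsto_seq {d : ℕ} {K : ℝ → (H0 d →L[ℂ] H0 d)}
    (hK : IsBoundedStronglyContinuous K) {lam : ℕ → ℝ} (hmem : ∀ j, lam j ∈ Set.Ico (0 : ℝ) 1)
    (hlim : Tendsto lam atTop (𝓝 0)) (u : H0 d) :
    Tendsto (fun j => K (lam j) u) atTop (𝓝 (K 0 u)) :=
  (hK.strongly_continuous 0 ⟨le_rfl, one_pos⟩ u).comp
    (tendsto_nhdsWithin_iff.mpr ⟨hlim, Eventually.of_forall hmem⟩)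

end BlockSchrodinger

end


/-! ### The contradiction argument. -/

theorem mainTheorem6 (d : ℕ) (hd : 1 ≤ d)
    (K₁ K₂ K : ℝ → (H0 d →L[ℂ] H0 d))
    (hK₁ : IsBoundedStronglyContinuous K₁)
    (hK₂ : IsBoundedStronglyContinuous K₂)
    (hK : IsBoundedStronglyContinuous K)
    (hK₁_sa : ∀ lam ∈ Set.Ico (0 : ℝ) 1, IsSelfAdjoint (K₁ lam))
    (hK₂_sa : ∀ lam ∈ Set.Ico (0 : ℝ) 1, IsSelfAdjoint (K₂ lam))
    (α β : ℕ → ℝ) (v w : ℕ → H2 d)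
    (hv : IsEigenEnumeration (schrodinger (K₁ 0)) α v)
    (hw : IsEigenEnumeration (schrodinger (K₂ 0)) β w)
    (σ : ℂ) (hσ : σ ∈ unboundedResolventSet (blockOp (K₁ 0) (K₂ 0) (K 0))) :
    ∃ N : ℕ, 0 < N ∧ ∃ lamStar : ℝ, 0 < lamStar ∧ lamStar ≤ 1 ∧
      ∀ n : ℕ, N < n → ∀ lam : ℝ, 0 < lam → lam < lamStar →
        σ ∈ resolventSet ℂ (truncBlockOp (K₁ lam) (K₂ lam) (K lam) v w n) := by
  have h0 : (0 : ℝ) ∈ Set.Ico (0 : ℝ) 1 := ⟨le_rfl, one_pos⟩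
  obtain ⟨c₁, R₁, hR₁⟩ := exists_isShiftedInverse (hK₁_sa 0 h0)
  obtain ⟨c₂, R₂, hR₂⟩ := exists_isShiftedInverse (hK₂_sa 0 h0)
  obtain ⟨C₁, hC₁⟩ := hK₁.bounded
  obtain ⟨C₂, hC₂⟩ := hK₂.bounded
  obtain ⟨C, hC⟩ := hK.bounded
  by_contra hcon
  have hseq : ∀ j : ℕ, ∃ n : ℕ, j < n ∧ ∃ lam : ℝ, 0 < lam ∧ lam < 1 / ((j : ℝ) + 1) ∧
      σ ∉ resolventSet ℂ (truncBlockOp (K₁ lam) (K₂ lam) (K lam) v w n) := by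
    intro j
    by_contra hj
    -- The choice `N = j + 1` keeps `N` positive when `j = 0`.
    refine hcon ⟨j + 1, j.succ_pos, 1 / ((j : ℝ) + 1), Nat.one_div_pos_of_nat, ?_, ?_⟩
    · rw [div_le_one (by positivity)]
      have : (0 : ℝ) ≤ j := j.cast_nonneg
      linarith
    · intro n hn lam hl hl'
      by_contra hr
      exact hj ⟨n, by omega, lam, hl, hl', hr⟩
  choose n hn lam hl0 hl1 hres using hseq
  have hlim : Tendsto lam atTop (𝓝 0) :=
    squeeze_zero (fun j => (hl0 j).le) (fun j => (hl1 j).le) tendsto_one_div_add_atTop_nhds_zero_nat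
  have hnlim : Tendsto n atTop atTop := tendsto_atTop_mono (fun j => (hn j).le) tendsto_id
  have hmem : ∀ j, lam j ∈ Set.Ico (0 : ℝ) 1 := fun j => by
    refine ⟨(hl0 j).le, (hl1 j).trans_le ?_⟩
    rw [div_le_one (by positivity)]
    have : (0 : ℝ) ≤ j := j.cast_nonneg
    linarith
  choose p q hpq hT using fun j => exists_normalized_eigenvector (hres j)
  have hfix := fun j => eq_of_truncBlockOp_apply hR₁ hR₂ hv hw _ _ _ (hT j)
  have hdiff : ∀ {L : ℝ → (H0 d →L[ℂ] H0 d)}, IsBoundedStronglyContinuous L → ∀ u : H0 d,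
      Tendsto (fun j => (L (lam j) - L 0) u) atTop (𝓝 0) := by
    intro L hL u
    simpa using (hL.tendsto_seq hmem hlim u).sub_const (L 0 u)
  obtain ⟨x, y, hne, hx, hy⟩ := exists_limit_solution hR₁.compact hR₂.compact hR₁.selfAdjoint
    hR₂.selfAdjoint (c₁ + σ) (c₂ - σ)
    (P := fun j => (firstSpan v (n j)).starProjection)
    (Q := fun j => (firstSpan w (n j)).starProjection)
    (L₁ := fun j => K₁ (lam j) - K₁ 0) (L₂ := fun j => K₂ (lam j) - K₂ 0)
    -- The maximum is a common bound; `C₁ + C₁` and `C₂ + C₂` bound the differences by the triangle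
    -- inequality.
    (B := fun j => K (lam j)) (B₀ := K 0) (C := max (C₁ + C₁) (max (C₂ + C₂) C))
    (fun j => Submodule.starProjection_norm_le _) (fun j => Submodule.starProjection_norm_le _)
    (fun j => Submodule.starProjection_isSymmetric _)
    (fun j => ((norm_sub_le _ _).trans (add_le_add (hC₁ _ (hmem j)) (hC₁ _ h0))).trans
      (le_max_left _ _))
    (fun j => ((norm_sub_le _ _).trans (add_le_add (hC₂ _ (hmem j)) (hC₂ _ h0))).trans
      ((le_max_left _ _).trans (le_max_right _ _)))
    (fun j => (hC _ (hmem j)).trans ((le_max_right _ _).trans (le_max_right _ _)))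
    (fun u => (tendsto_starProjection_firstSpan hR₁ hv u).comp hnlim)
    (fun u => (tendsto_starProjection_firstSpan hR₂ hw u).comp hnlim)
    (hdiff hK₁) (hdiff hK₂) (hK.tendsto_seq hmem hlim) hpq (fun j => (hfix j).1)
    (fun j => (hfix j).2)
  exact hne (eq_zero_of_mem_unboundedResolventSet hR₁ hR₂ hσ hx hy)
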